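/- **Theorem (statistical dimension on average of stabilizer states).** For $n \ge 0$ let $\mathcal P_n=\{\pm 1\}\cdot\{I,X,Y,Z\}^{\otimes n}$ be the set of signed $n$-qubit Pauli operators. Let $D$ be the uniform distribution over the $n$-qubit Pauli measurements $\{(I+P)/2 : P\in\mathcal P_n\}$, regarded as two-outcome measurements $E$ with $0 \le E\le I$. An $n$-qubit stabilizer pure state is a density matrix $\rho=|\psi\rangle\langle\psi|$, where $\psi \in \mathbb C^{2^n}$ is a unit vector with $P\psi=\psi$ for all $P$ in some Abelian group $S\subset\mathcal P_n\setminus\{-I\}$ of order $2^n$. Let $\mathcal C$ be the class of all functions $f_\rho(E)=2\,\mathrm{tr}(E\rho)-1$ on two-outcome measurements, with $\rho$ an $n$-qubit stabilizer pure state. For a finite nonempty class $\mathcal C'$ of real functions put $$\langle c,c'\rangle_D=\mathbb E_{E\sim D}[c(E)c'(E)],\qquad \rho_D(\mathcal C')=\frac1{|\mathcal C'|^2}\sum_{c,c'\in\mathcal C'}|\langle c,c'\rangle_D| .$$ For a finite nonempty class $\mathcal C$, let $\mathrm{sda}_D(\mathcal C,\gamma)$ be the largest integer $d$ with $1\le d\le|\mathcal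 C|$ such that $\rho_D(\mathcal C')\le\gamma$ for every $\mathcal C'\subseteq\mathcal C$ with $|\mathcal C'|\ge|\mathcal C|/d$. (For $d\ge|\mathcal C|$ the condition only says that $\rho_D(\mathcal C')\le\gamma$ for all nonempty $\mathcal C'\subseteq\mathcal C$, and no longer depends on $d$.) Then, for every $n$, the class $\mathcal C$ is finite, the maximum defining $\mathrm{sda}_D(\mathcal C,2^{-n})$ exists, and $$\mathrm{sda}_D\!\left(\mathcal C,\tfrac1{2^n}\right)=2^{\Theta(n^2)} \qquad (n\to\infty).$$ -/

import Mathlib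

open Filter MeasureTheory
open scoped Asymptotics Matrix ComplexOrder

noncomputable section

namespace StabSDA

/-! ### Statistical dimension on average -/

section StatisticalDimension

variable {X : Type*} [MeasurableSpace X]

/-- The inner product `⟨f, g⟩_D = 𝔼_{x ∼ D} [f x * g x]`. -/
def innerD (D : Measure X) (f g : X → ℝ) : ℝ := ∫ x, f x * g x ∂D

/-- The average (un-normalized) correlation `|C|⁻² ∑_{c, c' ∈ C} |⟨c, c'⟩_D|` of a finite
class of functions. -/
def avgCorrelation (D : Measure X) (C : Finset (X → ℝ)) : ℝ :=
  (1 / (C.card : ℝ) ^ 2) * ∑ c ∈ C, ∑ c' ∈ C, |innerD D c c'|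

/-- Every subclass `C' ⊆ C` with `|C'| ≥ |C| / d` has average correlation at most `γ`. -/
def LowCorrelation (D : Measure X) (C : Set (X → ℝ)) (γ : ℝ) (d : ℕ) : Prop :=
  ∀ C' : Finset (X → ℝ), (C' : Set (X → ℝ)) ⊆ C →
    (C.ncard : ℝ) / (d : ℝ) ≤ (C'.card : ℝ) → avgCorrelation D C' ≤ γ

/-- The values of `d` over which the statistical dimension is the maximum, for a finite class `C`.
For `d ≥ |C|` the condition `|C'| ≥ |C| / d` just says that `C'` is nonempty, so it no longer
depends on `d`; hence `d` ranges over `1, …, |C|`. By `isGreatest_sdaSet` below, this makes no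
difference whenever there is a largest `d` without the restriction. -/
def sdaSet (D : Measure X) (C : Set (X → ℝ)) (γ : ℝ) : Set ℕ :=
  {d | 1 ≤ d ∧ d ≤ C.ncard ∧ LowCorrelation D C γ d}

/-- The statistical dimension on average of `C` at threshold `γ`: the largest element of
`sdaSet D C γ`. -/
def sda (D : Measure X) (C : Set (X → ℝ)) (γ : ℝ) : ℕ := sSup (sdaSet D C γ)

/-- If there is a largest `d ≥ 1` with the defining property of the statistical dimension, with no
upper restriction on `d`, then it is also the largest element of `sdaSet D C γ`. -/
theorem isGreatest_sdaSet (D : Measure X) (C : Set (X → ℝ)) (γ : ℝ) (d : ℕ)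
    (h : IsGreatest {d : ℕ | 1 ≤ d ∧ LowCorrelation D C γ d} d) :
    IsGreatest (sdaSet D C γ) d := by
  obtain ⟨⟨h1, h2⟩, h3⟩ := h
  refine ⟨⟨h1, ?_, h2⟩, fun e he => h3 ⟨he.1, he.2.2⟩⟩
  by_contra hlt
  have hlt' : C.ncard ≤ d := by omega
  have hd : (0 : ℝ) < d := by exact_mod_cast h1
  have key : LowCorrelation D C γ (d + 1) := by
    intro C' hC' hcard
    refine h2 C' hC' ?_
    rcases Nat.eq_zero_or_pos C'.card with h0 | h0
    · rw [h0, Nat.cast_zero] at hcard ⊢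
      have hd' : (0 : ℝ) < ((d + 1 : ℕ) : ℝ) := by positivity
      have h4 : (C.ncard : ℝ) ≤ 0 := by
        by_contra hc
        exact absurd (div_pos (not_le.mp hc) hd') (not_lt.mpr hcard)
      exact div_nonpos_of_nonpos_of_nonneg h4 hd.le
    · calc (C.ncard : ℝ) / d ≤ 1 := (div_le_one hd).2 (by exact_mod_cast hlt')
        _ ≤ C'.card := by exact_mod_cast h0
  have := h3 (show d + 1 ∈ {d : ℕ | 1 ≤ d ∧ LowCorrelation D C γ d} from ⟨by omega, key⟩)
  omega

end StatisticalDimension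

/-! ### Qubits, Pauli operators and stabilizer states -/

/-- Operators on `n` qubits: complex matrices indexed by the bit strings of length `n`. -/
abbrev QubitOp (n : ℕ) : Type := Matrix (Fin n → Fin 2) (Fin n → Fin 2) ℂ

/-- The single-qubit Pauli matrices `I, X, Y, Z`. -/
def pauli : Fin 4 → Matrix (Fin 2) (Fin 2) ℂ :=
  ![!![1, 0; 0, 1], !![0, 1; 1, 0], !![0, -Complex.I; Complex.I, 0], !![1, 0; 0, -1]]

/-- The tensor product `pauli (σ 0) ⊗ ⋯ ⊗ pauli (σ (n - 1))`. -/
def pauliString {n : ℕ} (σ : Fin n → Fin 4) : QubitOp n :=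
  Matrix.of fun x y => ∏ i, pauli (σ i) (x i) (y i)

/-- The `n`-qubit Pauli operators `{±1} · {I, X, Y, Z}^{⊗ n}`. -/
def pauliOps (n : ℕ) : Set (QubitOp n) :=
  {P | ∃ σ : Fin n → Fin 4, P = pauliString σ ∨ P = -pauliString σ}

/-- `S` is an Abelian group of order `2 ^ n` of Pauli operators that does not contain `-I`. -/
structure IsStabilizerGroup {n : ℕ} (S : Subgroup (QubitOp n)ˣ) : Prop where
  subset_pauliOps : ∀ P ∈ S, (P : QubitOp n) ∈ pauliOps n
  neg_one_notMem : (-1 : (QubitOp n)ˣ) ∉ S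
  comm : ∀ P ∈ S, ∀ Q ∈ S, P * Q = Q * P
  card_eq : Nat.card S = 2 ^ n

/-- The density matrices `|ψ⟩⟨ψ|` of the `n`-qubit stabilizer pure states: `ψ` is a unit vector
fixed by all elements of a stabilizer group. -/
def stabilizerStates (n : ℕ) : Set (QubitOp n) :=
  {ρ | ∃ S : Subgroup (QubitOp n)ˣ, IsStabilizerGroup S ∧
    ∃ ψ : (Fin n → Fin 2) → ℂ, star ψ ⬝ᵥ ψ = 1 ∧
      (∀ P ∈ S, (P : QubitOp n) *ᵥ ψ = ψ) ∧ ρ = Matrix.vecMulVec ψ (star ψ)}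

/-! ### Two-outcome measurements and the associated concepts -/

/-- Two-outcome `n`-qubit measurements, given by an operator `E` with `0 ≤ E ≤ I`
(the POVM `{E, I - E}`). -/
def Effect (n : ℕ) : Type :=
  {E : QubitOp n // E.PosSemidef ∧ (1 - E).PosSemidef}

instance instTopologicalSpaceEffect (n : ℕ) : TopologicalSpace (Effect n) :=
  inferInstanceAs (TopologicalSpace {E : QubitOp n // E.PosSemidef ∧ (1 - E).PosSemidef})

instance instMeasurableSpaceEffect (n : ℕ) : MeasurableSpace (Effect n) := borel (Effect n)

/-- The concept `f_ρ (E) = 2 tr(E ρ) - 1` of a state `ρ`. -/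
def concept {n : ℕ} (ρ : QubitOp n) : Effect n → ℝ :=
  fun E => 2 * (Matrix.trace (E.1 * ρ)).re - 1

/-- The concept class of all `n`-qubit stabilizer pure states. -/
def stabilizerClass (n : ℕ) : Set (Effect n → ℝ) := concept '' stabilizerStates n

/-- The Pauli measurements `(I + P) / 2`, with `P` a Pauli operator. -/
def pauliMeasurements (n : ℕ) : Set (Effect n) :=
  {E | ∃ P ∈ pauliOps n, E.1 = (1 / 2 : ℂ) • (1 + P)}

/-- The uniform distribution over the `n`-qubit Pauli measurements. -/
def uniformPauli (n : ℕ) : Measure (Effect n) :=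
  ProbabilityTheory.uniformOn (pauliMeasurements n)

end StabSDA

end

namespace StabSDA

variable {n : ℕ}

/-! ### Pauli strings -/

/-! The threshold `2⁻ⁿ` is so generous that the statistical dimension is simply the number of
stabilizer states. On a Pauli measurement `(I + P)/2` the concept of `ρ` takes the value `tr (P ρ)`,
so the correlation of two concepts is `4⁻ⁿ ∑ tr (P ρ) tr (P ρ')` over unsigned strings. By Parseval
(`sum_trace_pauliString_mul`) the squared coefficients of a pure state sum to `2 ^ n`, hence every
pair, the diagonal ones included, has correlation at most `2⁻ⁿ` (`abs_innerD_concept_pureState_le`).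
All subclasses therefore qualify, and `sda` equals its cap `|C|` (`sda_stabilizerClass`).

It remains to count. Above: a state is determined by its stabilizer group
(`pureState_eq_of_stabilized`), which is generated by `n` of the `2 * 4 ^ n` Pauli operators. Below:
the graph states, with signs given by quadratic forms over the two-element field, supply `2 ^ (n (n
- 1) / 2)` different states (`two_pow_le_ncard_stabilizerClass`). Both exponents are of order `n²`.
-/

theorem pauli_completeness (a b c d : Fin 2) :
    ∑ s, pauli s a b * pauli s c d = if a = d ∧ b = c then 2 else 0 := by
  fin_cases a <;> fin_cases b <;> fin_cases c <;> fin_cases d <;>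
    simp [pauli, Fin.sum_univ_four] <;> norm_num

theorem pauli_orthogonal (s t : Fin 4) :
    ∑ a, ∑ b, pauli s a b * pauli t b a = if s = t then 2 else 0 := by
  fin_cases s <;> fin_cases t <;> simp [pauli, Fin.sum_univ_two] <;> norm_num

theorem pauli_mul_self_apply (s : Fin 4) (a c : Fin 2) :
    ∑ b, pauli s a b * pauli s b c = if a = c then 1 else 0 := by
  fin_cases s <;> fin_cases a <;> fin_cases c <;> simp [pauli, Fin.sum_univ_two]

theorem star_pauli_apply (s : Fin 4) (a b : Fin 2) : star (pauli s b a) = pauli s a b := by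
  fin_cases s <;> fin_cases a <;> fin_cases b <;> simp [pauli]

theorem pauliString_apply (σ : Fin n → Fin 4) (x y : Fin n → Fin 2) :
    pauliString σ x y = ∏ i, pauli (σ i) (x i) (y i) := rfl

theorem prod_ite_one_zero {ι R : Type*} [Fintype ι] [CommSemiring R] (p : ι → Prop)
    [DecidablePred p] [Decidable (∀ i, p i)] (c : R) :
    ∏ i, (if p i then c else 0) = if ∀ i, p i then c ^ Fintype.card ι else 0 := by
  split_ifs with h
  · simp [h]
  · push Not at h
    obtain ⟨i, hi⟩ := h
    exact Finset.prod_eq_zero (Finset.mem_univ i) (if_neg hi)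

/-- In operator form, `∑ P ⊗ P` is `2 ^ n` times the swap. The sum over strings factors into one
single-qubit sum per position. -/
theorem pauliString_completeness (a b c d : Fin n → Fin 2) :
    ∑ σ, pauliString σ a b * pauliString σ c d = if a = d ∧ b = c then (2 : ℂ) ^ n else 0 := by
  have h := Finset.prod_univ_sum (fun _ : Fin n => (Finset.univ : Finset (Fin 4)))
    (fun i s => pauli s (a i) (b i) * pauli s (c i) (d i))
  simp only [pauli_completeness, Fintype.piFinset_univ, Finset.prod_mul_distrib] at h
  simp only [pauliString_apply]
  rw [← h, prod_ite_one_zero]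
  simp [funext_iff, forall_and]

theorem trace_pauliString_mul (σ τ : Fin n → Fin 4) :
    (pauliString σ * pauliString τ).trace = if σ = τ then (2 : ℂ) ^ n else 0 := by
  have h := Finset.prod_univ_sum (fun _ : Fin n => (Finset.univ : Finset (Fin 2 × Fin 2)))
    (fun i p => pauli (σ i) p.1 p.2 * pauli (τ i) p.2 p.1)
  simp only [Fintype.sum_prod_type, pauli_orthogonal, Fintype.piFinset_univ,
    Finset.prod_mul_distrib] at h
  rw [prod_ite_one_zero] at h
  simp only [Matrix.trace, Matrix.diag, Matrix.mul_apply, pauliString_apply]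
  rw [← Fintype.sum_prod_type',
    ← (Equiv.arrowProdEquivProdArrow (Fin n) (fun _ => Fin 2) (fun _ => Fin 2)).sum_comp]
  simpa [Equiv.arrowProdEquivProdArrow, funext_iff] using h.symm

theorem pauliString_mul_self (σ : Fin n → Fin 4) : pauliString σ * pauliString σ = 1 := by
  ext x z
  have h := Finset.prod_univ_sum (fun _ : Fin n => (Finset.univ : Finset (Fin 2)))
    (fun i b => pauli (σ i) (x i) b * pauli (σ i) b (z i))
  simp only [pauli_mul_self_apply, Fintype.piFinset_univ, Finset.prod_mul_distrib] at h
  rw [prod_ite_one_zero] at h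
  simp only [Matrix.mul_apply, pauliString_apply]
  rw [← h]
  simp [Matrix.one_apply, funext_iff]

theorem pauliString_isHermitian (σ : Fin n → Fin 4) : (pauliString σ).IsHermitian := by
  ext x y
  simp [Matrix.conjTranspose_apply, pauliString_apply, ← star_pauli_apply _ (x _) (y _)]

/-- Parseval's identity for Pauli expansions. -/
theorem sum_trace_pauliString_mul (A B : QubitOp n) :
    ∑ σ, (pauliString σ * A).trace * (pauliString σ * B).trace = 2 ^ n * (A * B).trace := by
  have h : ∀ σ : Fin n → Fin 4, (pauliString σ * A).trace * (pauliString σ * B).trace =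
      ∑ a, ∑ b, ∑ c, ∑ d, (pauliString σ a b * pauliString σ c d) * (A b a * B d c) := by
    intro σ
    simp only [Matrix.trace, Matrix.diag, Matrix.mul_apply, Finset.sum_mul]
    simp only [Finset.mul_sum]
    refine Finset.sum_congr rfl fun a _ => Finset.sum_congr rfl fun b _ =>
      Finset.sum_congr rfl fun c _ => Finset.sum_congr rfl fun d _ => by ring
  simp only [h]
  calc _ = ∑ a, ∑ b, ∑ c, ∑ d,
        (∑ σ : Fin n → Fin 4, pauliString σ a b * pauliString σ c d) * (A b a * B d c) := by
        rw [Finset.sum_comm]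
        refine Finset.sum_congr rfl fun a _ => ?_
        rw [Finset.sum_comm]
        refine Finset.sum_congr rfl fun b _ => ?_
        rw [Finset.sum_comm]
        refine Finset.sum_congr rfl fun c _ => ?_
        rw [Finset.sum_comm]
        exact Finset.sum_congr rfl fun d _ => (Finset.sum_mul ..).symm
    _ = ∑ a, ∑ b, 2 ^ n * (A b a * B a b) := by
        simp only [pauliString_completeness, ite_and, ite_mul, zero_mul]
        simp
    _ = 2 ^ n * (A * B).trace := by
        rw [Finset.sum_comm]
        simp [Matrix.trace, Matrix.mul_apply, Finset.mul_sum]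

/-- The Pauli operator `± pauliString σ`, with the sign `-` if the flag is set. -/
noncomputable def signedPauli (p : Bool × (Fin n → Fin 4)) : QubitOp n :=
  (if p.1 then -1 else 1 : ℂ) • pauliString p.2

theorem range_signedPauli : Set.range (signedPauli (n := n)) = pauliOps n := by
  ext P
  simp only [Set.mem_range, Prod.exists, Bool.exists_bool, signedPauli, pauliOps,
    Set.mem_ofPred_eq]
  constructor
  · rintro (⟨σ, h⟩ | ⟨σ, h⟩)
    · exact ⟨σ, Or.inl (by simpa using h.symm)⟩
    · exact ⟨σ, Or.inr (by simpa using h.symm)⟩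
  · rintro ⟨σ, h | h⟩
    · exact Or.inl ⟨σ, by simp [h]⟩
    · exact Or.inr ⟨σ, by simp [h]⟩

theorem signedPauli_injective : Function.Injective (signedPauli (n := n)) := by
  rintro ⟨ε, σ⟩ ⟨ε', τ⟩ h
  -- Pairing with `pauliString σ` extracts the coefficient at `σ`, which reveals first the string
  -- and then the sign.
  have h1 := congrArg (fun M => (M * pauliString σ).trace) h
  simp only [signedPauli, Matrix.smul_mul, Matrix.trace_smul, trace_pauliString_mul] at h1
  have h2 : (2 : ℂ) ^ n ≠ 0 := by positivity
  by_cases hστ : τ = σ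
  · subst hστ
    cases ε <;> cases ε' <;> simp_all [neg_eq_iff_add_eq_zero, eq_neg_iff_add_eq_zero]
  · cases ε <;> simp_all

theorem pauliOps_finite (n : ℕ) : (pauliOps n).Finite := by
  rw [← range_signedPauli]
  exact Set.finite_range _

theorem card_pauliOps (n : ℕ) : Nat.card (pauliOps n) = 2 * 4 ^ n := by
  rw [← range_signedPauli, Nat.card_range_of_injective signedPauli_injective]
  simp

theorem isHermitian_of_mem_pauliOps {P : QubitOp n} (hP : P ∈ pauliOps n) : P.IsHermitian := by
  obtain ⟨σ, rfl | rfl⟩ := hP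
  · exact pauliString_isHermitian σ
  · exact (pauliString_isHermitian σ).neg

theorem mul_self_of_mem_pauliOps {P : QubitOp n} (hP : P ∈ pauliOps n) : P * P = 1 := by
  obtain ⟨σ, rfl | rfl⟩ := hP
  · exact pauliString_mul_self σ
  · simpa using pauliString_mul_self σ

theorem neg_mem_pauliOps {P : QubitOp n} (hP : P ∈ pauliOps n) : -P ∈ pauliOps n := by
  obtain ⟨σ, rfl | rfl⟩ := hP
  · exact ⟨σ, Or.inr rfl⟩
  · exact ⟨σ, Or.inl (neg_neg _)⟩

/-! ### Pauli measurements -/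

/-- As `P` is a Hermitian involution, `(I + P)/2` is an orthogonal projection and equals its own
Gram matrix. -/
theorem posSemidef_half_one_add {P : QubitOp n} (hP : P ∈ pauliOps n) :
    ((1 / 2 : ℂ) • (1 + P)).PosSemidef := by
  have h : ((1 / 2 : ℂ) • (1 + P)) =
      ((1 / 2 : ℂ) • (1 + P))ᴴ * ((1 / 2 : ℂ) • (1 + P)) := by
    rw [Matrix.conjTranspose_smul, Matrix.conjTranspose_add, Matrix.conjTranspose_one,
      (isHermitian_of_mem_pauliOps hP).eq, Matrix.smul_mul, Matrix.mul_smul, add_mul, mul_add,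
      mul_add, mul_self_of_mem_pauliOps hP, smul_smul, one_mul, one_mul, mul_one, add_comm P 1,
      ← two_smul ℂ (1 + P), smul_smul]
    norm_num
  rw [h]
  exact Matrix.posSemidef_conjTranspose_mul_self _

/-- The measurement `(I + P) / 2` of a signed Pauli operator `P`. -/
noncomputable def pauliEffect (p : Bool × (Fin n → Fin 4)) : Effect n :=
  ⟨(1 / 2 : ℂ) • (1 + signedPauli p), by
    have hp : signedPauli p ∈ pauliOps n := range_signedPauli ▸ Set.mem_range_self p
    refine ⟨posSemidef_half_one_add hp, ?_⟩
    have h : 1 - (1 / 2 : ℂ) • (1 + signedPauli p) = (1 / 2 : ℂ) • (1 + -signedPauli p) := by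
      module
    rw [h]
    exact posSemidef_half_one_add (neg_mem_pauliOps hp)⟩

theorem pauliEffect_injective : Function.Injective (pauliEffect (n := n)) := by
  intro p q h
  have h1 : (1 / 2 : ℂ) • (1 + signedPauli p) = (1 / 2 : ℂ) • (1 + signedPauli q) :=
    congrArg Subtype.val h
  have h2 := smul_right_injective (QubitOp n) (by norm_num : (1 / 2 : ℂ) ≠ 0) h1
  exact signedPauli_injective (add_left_cancel h2)

theorem pauliMeasurements_eq_range : pauliMeasurements n = Set.range pauliEffect := by
  ext E
  simp only [pauliMeasurements, Set.mem_ofPred_eq, ← range_signedPauli, Set.mem_range,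
    exists_exists_eq_and]
  exact exists_congr fun p => ⟨fun h => Subtype.ext h.symm, fun h => (congrArg Subtype.val h).symm⟩

instance instMeasurableSingletonClassEffect (n : ℕ) : MeasurableSingletonClass (Effect n) := by
  have : T1Space (Effect n) :=
    inferInstanceAs (T1Space {E : QubitOp n // E.PosSemidef ∧ (1 - E).PosSemidef})
  have : BorelSpace (Effect n) := ⟨rfl⟩
  infer_instance

theorem integral_uniformOn_coe_finset {Ω : Type*} [MeasurableSpace Ω] [MeasurableSingletonClass Ω]
    (s : Finset Ω) (f : Ω → ℝ) :
    ∫ x, f x ∂ProbabilityTheory.uniformOn (s : Set Ω) = (s.card : ℝ)⁻¹ * ∑ x ∈ s, f x := by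
  have hf : IntegrableOn f s Measure.count := by
    rw [← Set.biUnion_of_singleton (s : Set Ω)]
    refine integrableOn_finset_iUnion.2 fun x _ => ?_
    exact integrableOn_singleton (hx := by simp)
  rw [ProbabilityTheory.uniformOn, ProbabilityTheory.cond, integral_smul_measure,
    setIntegral_finset _ hf]
  simp [Measure.count_apply_finset, Measure.real]

theorem integral_uniformPauli (f : Effect n → ℝ) :
    ∫ E, f E ∂uniformPauli n = (2 * 4 ^ n : ℝ)⁻¹ * ∑ p, f (pauliEffect p) := by
  classical
  rw [uniformPauli, pauliMeasurements_eq_range,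
    ← Set.image_univ, ← Finset.coe_univ, ← Finset.coe_image,
    integral_uniformOn_coe_finset, Finset.card_image_of_injective _ pauliEffect_injective,
    Finset.sum_image fun _ _ _ _ h => pauliEffect_injective h]
  simp

/-! ### Pure states and their Pauli coefficients -/

/-- The coefficient `tr (P ρ)` of a Hermitian operator `ρ` at the Pauli string `P`. -/
noncomputable def pauliCoeff (ρ : QubitOp n) (σ : Fin n → Fin 4) : ℝ :=
  (pauliString σ * ρ).trace.re

/-- The projector `|ψ⟩⟨ψ|`. -/
noncomputable def pureState (ψ : (Fin n → Fin 2) → ℂ) : QubitOp n :=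
  Matrix.vecMulVec ψ (star ψ)

theorem pureState_isHermitian (ψ : (Fin n → Fin 2) → ℂ) : (pureState ψ).IsHermitian := by
  ext x y
  simp [pureState, Matrix.vecMulVec_apply, mul_comm]

theorem trace_pureState {ψ : (Fin n → Fin 2) → ℂ} (hψ : star ψ ⬝ᵥ ψ = 1) :
    (pureState ψ).trace = 1 := by
  rw [pureState, Matrix.trace_vecMulVec, dotProduct_comm, hψ]

theorem pureState_mul_self {ψ : (Fin n → Fin 2) → ℂ} (hψ : star ψ ⬝ᵥ ψ = 1) :
    pureState ψ * pureState ψ = pureState ψ := by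
  rw [pureState, Matrix.vecMulVec_mul_vecMulVec, hψ, one_smul]

theorem sum_pauliCoeff_sq {ρ : QubitOp n} (hρ : ρ.IsHermitian) :
    ((∑ σ, pauliCoeff ρ σ ^ 2 : ℝ) : ℂ) = 2 ^ n * (ρ * ρ).trace := by
  -- The trace of a product of two Hermitian operators is real, so taking real parts loses nothing.
  have h : ∀ σ, (pauliCoeff ρ σ : ℂ) = (pauliString σ * ρ).trace := by
    intro σ
    refine Complex.conj_eq_iff_re.1 ?_
    rw [starRingEnd_apply, ← Matrix.trace_conjTranspose, Matrix.conjTranspose_mul, hρ.eq,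
      (pauliString_isHermitian σ).eq, Matrix.trace_mul_comm]
  rw [← sum_trace_pauliString_mul]
  push_cast
  simp only [h, sq]

theorem sum_pauliCoeff_pureState_sq {ψ : (Fin n → Fin 2) → ℂ} (hψ : star ψ ⬝ᵥ ψ = 1) :
    ∑ σ, pauliCoeff (pureState ψ) σ ^ 2 = 2 ^ n := by
  have h := sum_pauliCoeff_sq (pureState_isHermitian ψ)
  rw [pureState_mul_self hψ, trace_pureState hψ, mul_one] at h
  exact_mod_cast h

/-- By Parseval, the squared Frobenius norm of `ρ - ρ'` vanishes when all its coefficients do. -/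
theorem pauliCoeff_injOn {ρ ρ' : QubitOp n} (hρ : ρ.IsHermitian) (hρ' : ρ'.IsHermitian)
    (h : pauliCoeff ρ = pauliCoeff ρ') : ρ = ρ' := by
  have h0 : ∀ σ, pauliCoeff (ρ - ρ') σ = 0 := by
    intro σ
    have := congrFun h σ
    simp only [pauliCoeff] at this ⊢
    rw [mul_sub, Matrix.trace_sub, Complex.sub_re, this, sub_self]
  have h1 := sum_pauliCoeff_sq (hρ.sub hρ')
  simp only [h0] at h1
  have h2 : (2 : ℂ) ^ n ≠ 0 := by positivity
  have h3 : ((ρ - ρ') * (ρ - ρ')).trace = 0 := by simpa [h2] using h1.symm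
  nth_rw 1 [← (hρ.sub hρ').eq] at h3
  exact sub_eq_zero.1 (Matrix.trace_conjTranspose_mul_self_eq_zero_iff.1 h3)

theorem concept_pauliEffect {ρ : QubitOp n} (hρ : ρ.trace = 1) (p : Bool × (Fin n → Fin 4)) :
    concept ρ (pauliEffect p) = (if p.1 then -1 else 1) * pauliCoeff ρ p.2 := by
  have h : ((1 / 2 : ℂ) • (1 + signedPauli p) * ρ).trace =
      1 / 2 * (1 + (if p.1 then -1 else 1) * (pauliString p.2 * ρ).trace) := by
    rw [Matrix.smul_mul, Matrix.trace_smul, add_mul, one_mul, Matrix.trace_add, hρ, signedPauli,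
      Matrix.smul_mul, Matrix.trace_smul, smul_eq_mul, smul_eq_mul]
  simp only [concept, pauliEffect, h, pauliCoeff]
  rw [show (1 / 2 : ℂ) = ((1 / 2 : ℝ) : ℂ) by norm_num, Complex.re_ofReal_mul]
  split_ifs <;> simp

theorem eq_of_concept_eq {ρ ρ' : QubitOp n} (hρ : ρ.IsHermitian) (hρ' : ρ'.IsHermitian)
    (htr : ρ.trace = 1) (htr' : ρ'.trace = 1) (h : concept ρ = concept ρ') : ρ = ρ' := by
  refine pauliCoeff_injOn hρ hρ' (funext fun σ => ?_)
  have := congrFun h (pauliEffect (false, σ))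
  simpa [concept_pauliEffect htr, concept_pauliEffect htr'] using this

/-! ### Correlations -/

theorem abs_innerD_concept_pureState_le {ψ φ : (Fin n → Fin 2) → ℂ} (hψ : star ψ ⬝ᵥ ψ = 1)
    (hφ : star φ ⬝ᵥ φ = 1) :
    |innerD (uniformPauli n) (concept (pureState ψ)) (concept (pureState φ))| ≤ 1 / 2 ^ n := by
  have h : innerD (uniformPauli n) (concept (pureState ψ)) (concept (pureState φ)) =
      (4 ^ n : ℝ)⁻¹ * ∑ σ, pauliCoeff (pureState ψ) σ * pauliCoeff (pureState φ) σ := by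
    rw [innerD, integral_uniformPauli, Fintype.sum_prod_type]
    simp only [concept_pauliEffect (trace_pureState hψ), concept_pauliEffect (trace_pureState hφ),
      Fintype.sum_bool]
    simp only [if_true, Bool.false_eq_true, if_false, neg_one_mul, neg_mul_neg, one_mul]
    field_simp
    ring
  have hsum : |∑ σ, pauliCoeff (pureState ψ) σ * pauliCoeff (pureState φ) σ| ≤ 2 ^ n :=
    calc _ ≤ ∑ σ, |pauliCoeff (pureState ψ) σ * pauliCoeff (pureState φ) σ| :=
          Finset.abs_sum_le_sum_abs _ _
      -- AM-GM termwise suffices in place of Cauchy–Schwarz, since both sums of squares equal `2 ^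
      -- n`.
      _ ≤ ∑ σ, (pauliCoeff (pureState ψ) σ ^ 2 + pauliCoeff (pureState φ) σ ^ 2) / 2 := by
          refine Finset.sum_le_sum fun σ _ => ?_
          rw [abs_mul]
          nlinarith [sq_nonneg (|pauliCoeff (pureState ψ) σ| - |pauliCoeff (pureState φ) σ|),
            sq_abs (pauliCoeff (pureState ψ) σ), sq_abs (pauliCoeff (pureState φ) σ)]
      _ = 2 ^ n := by
          rw [← Finset.sum_div, Finset.sum_add_distrib, sum_pauliCoeff_pureState_sq hψ,
            sum_pauliCoeff_pureState_sq hφ, add_self_div_two]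
  rw [h, abs_mul, abs_of_nonneg (by positivity)]
  calc _ ≤ (4 ^ n : ℝ)⁻¹ * 2 ^ n := by gcongr
    _ = 1 / 2 ^ n := by
      rw [show (4 : ℝ) = 2 * 2 by norm_num, mul_pow]
      field_simp

theorem avgCorrelation_le {X : Type*} [MeasurableSpace X] {D : Measure X} {C : Finset (X → ℝ)}
    {γ : ℝ} (hγ : 0 ≤ γ) (h : ∀ c ∈ C, ∀ c' ∈ C, |innerD D c c'| ≤ γ) :
    avgCorrelation D C ≤ γ := by
  have hsum : ∑ c ∈ C, ∑ c' ∈ C, |innerD D c c'| ≤ (C.card : ℝ) ^ 2 * γ :=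
    calc _ ≤ ∑ c ∈ C, ∑ c' ∈ C, γ :=
          Finset.sum_le_sum fun c hc => Finset.sum_le_sum fun c' hc' => h c hc c' hc'
      _ = _ := by simp; ring
  rcases Nat.eq_zero_or_pos C.card with h0 | h0
  · simpa [avgCorrelation, h0] using hγ
  · have h1 : (0 : ℝ) < (C.card : ℝ) ^ 2 := by positivity
    rw [avgCorrelation, one_div, inv_mul_le_iff₀ h1]
    exact hsum

/-- The bound holds pair by pair, hence for subclasses of every size and for every `d`. -/
theorem lowCorrelation_stabilizerClass (n d : ℕ) :
    LowCorrelation (uniformPauli n) (stabilizerClass n) (1 / 2 ^ n) d := by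
  intro C' hC' _
  refine avgCorrelation_le (by positivity) fun c hc c' hc' => ?_
  obtain ⟨_, ⟨_, _, ψ, hψ, _, rfl⟩, rfl⟩ := hC' hc
  obtain ⟨_, ⟨_, _, φ, hφ, _, rfl⟩, rfl⟩ := hC' hc'
  exact abs_innerD_concept_pureState_le hψ hφ

theorem isGreatest_sdaSet_stabilizerClass (hfin : (stabilizerClass n).Finite)
    (hne : (stabilizerClass n).Nonempty) :
    IsGreatest (sdaSet (uniformPauli n) (stabilizerClass n) (1 / 2 ^ n))
      (stabilizerClass n).ncard :=
  ⟨⟨(Set.ncard_pos hfin).2 hne, le_rfl, lowCorrelation_stabilizerClass n _⟩, fun _ hd => hd.2.1⟩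

theorem sda_stabilizerClass (hfin : (stabilizerClass n).Finite)
    (hne : (stabilizerClass n).Nonempty) :
    sda (uniformPauli n) (stabilizerClass n) (1 / 2 ^ n) = (stabilizerClass n).ncard :=
  (isGreatest_sdaSet_stabilizerClass hfin hne).csSup_eq

/-! ### A stabilizer group determines its state -/

theorem trace_mul_pureState_of_mulVec_eq {P : QubitOp n} {ψ : (Fin n → Fin 2) → ℂ}
    (hψ : star ψ ⬝ᵥ ψ = 1) (h : P *ᵥ ψ = ψ) : (P * pureState ψ).trace = 1 := by
  rw [pureState, Matrix.mul_vecMulVec, h, ← pureState, trace_pureState hψ]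

/-- The `2 ^ n` elements of `S` sit on distinct Pauli strings and force the coefficients there to be
`±1`. Their squares already exhaust the Parseval total `2 ^ n`, so all other coefficients vanish,
and `S` determines the whole expansion. -/
theorem pureState_eq_of_stabilized {S : Subgroup (QubitOp n)ˣ} (hS : IsStabilizerGroup S)
    {ψ φ : (Fin n → Fin 2) → ℂ} (hψ : star ψ ⬝ᵥ ψ = 1) (hφ : star φ ⬝ᵥ φ = 1)
    (hSψ : ∀ P ∈ S, (P : QubitOp n) *ᵥ ψ = ψ) (hSφ : ∀ P ∈ S, (P : QubitOp n) *ᵥ φ = φ) :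
    pureState ψ = pureState φ := by
  classical
  have : Finite S := Nat.finite_of_card_ne_zero (by rw [hS.card_eq]; positivity)
  have := Fintype.ofFinite S
  choose s hs using fun P : S => hS.subset_pauliOps P P.2
  have hinj : Function.Injective s := by
    intro P Q hPQ
    -- Two elements on the same string differ at most by a sign; if `P = -Q`, then `P * Q = -I`
    -- would lie in `S`.
    have key : (P.1 : QubitOp n) ≠ -(Q.1 : QubitOp n) := by
      intro h
      refine hS.neg_one_notMem ?_
      have hmul : P.1 * Q.1 = -1 := by
        ext1
        simp [h, mul_self_of_mem_pauliOps (hS.subset_pauliOps Q Q.2)]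
      exact hmul ▸ S.mul_mem P.2 Q.2
    refine Subtype.ext (Units.ext ?_)
    have hP := hs P
    have hQ := hs Q
    rw [← hPQ] at hQ
    rcases hP with hP | hP <;> rcases hQ with hQ | hQ
    · rw [hP, hQ]
    · exact absurd (by rw [hP, hQ, neg_neg]) key
    · exact absurd (by rw [hP, hQ]) key
    · rw [hP, hQ]
  have hval : ∀ χ : (Fin n → Fin 2) → ℂ, star χ ⬝ᵥ χ = 1 →
      (∀ P ∈ S, (P : QubitOp n) *ᵥ χ = χ) → ∀ P : S,
      pauliCoeff (pureState χ) (s P) = if (P.1 : QubitOp n) = pauliString (s P) then 1 else -1 := by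
    intro χ hχ hSχ P
    have h1 := trace_mul_pureState_of_mulVec_eq hχ (hSχ P P.2)
    rw [pauliCoeff]
    split_ifs with h
    · rw [← h, h1, Complex.one_re]
    · have h2 := (hs P).resolve_left h
      rw [← neg_eq_iff_eq_neg] at h2
      rw [← h2, neg_mul, Matrix.trace_neg, h1, Complex.neg_re, Complex.one_re]
  have hzero : ∀ χ : (Fin n → Fin 2) → ℂ, star χ ⬝ᵥ χ = 1 →
      (∀ P ∈ S, (P : QubitOp n) *ᵥ χ = χ) → ∀ σ, σ ∉ Set.range s →
      pauliCoeff (pureState χ) σ = 0 := by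
    intro χ hχ hSχ σ hσ
    have h1 : ∑ τ ∈ Finset.univ.image s, pauliCoeff (pureState χ) τ ^ 2 = 2 ^ n := by
      rw [Finset.sum_image fun _ _ _ _ h => hinj h]
      have h2 : ∀ P : S, pauliCoeff (pureState χ) (s P) ^ 2 = 1 := by
        intro P
        rw [hval χ hχ hSχ P]
        split_ifs <;> norm_num
      simp only [h2, Finset.sum_const, Finset.card_univ, nsmul_eq_mul, mul_one]
      rw [← Nat.card_eq_fintype_card, hS.card_eq]
      norm_num
    have h3 := sum_pauliCoeff_pureState_sq hχ
    rw [← Finset.sum_add_sum_compl (Finset.univ.image s), h1, add_eq_left,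
      Finset.sum_eq_zero_iff_of_nonneg fun _ _ => sq_nonneg _] at h3
    exact pow_eq_zero_iff two_ne_zero |>.1 (h3 σ (by simpa using hσ))
  refine pauliCoeff_injOn (pureState_isHermitian ψ) (pureState_isHermitian φ) (funext fun σ => ?_)
  by_cases hσ : σ ∈ Set.range s
  · obtain ⟨P, rfl⟩ := hσ
    rw [hval ψ hψ hSψ, hval φ hφ hSφ]
  · rw [hzero ψ hψ hSψ σ hσ, hzero φ hφ hSφ σ hσ]

/-! ### Upper bound on the number of stabilizer states -/

/-- By Lagrange, adjoining an element outside the subgroup generated so far at least doubles its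
order, so `n` generators suffice. -/
theorem exists_closure_range_eq_top_of_card_le {G : Type*} [Group G] [Finite G] {n : ℕ}
    (h : Nat.card G ≤ 2 ^ n) : ∃ t : Fin n → G, Subgroup.closure (Set.range t) = ⊤ := by
  have key : ∀ k, ∃ t : Fin k → G, Subgroup.closure (Set.range t) = ⊤ ∨
      2 ^ k ≤ Nat.card (Subgroup.closure (Set.range t)) := by
    intro k
    induction k with
    | zero => exact ⟨Fin.elim0, Or.inr Nat.card_pos⟩
    | succ k ih =>
      obtain ⟨t, ht⟩ := ih
      by_cases htop : Subgroup.closure (Set.range t) = ⊤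
      · refine ⟨Fin.cons 1 t, Or.inl (top_le_iff.1 ?_)⟩
        rw [← htop, Fin.range_cons]
        exact Subgroup.closure_mono (Set.subset_insert _ _)
      · have hcard := ht.resolve_left htop
        obtain ⟨g, hg⟩ : ∃ g, g ∉ Subgroup.closure (Set.range t) := by
          by_contra! hall
          exact htop (Subgroup.eq_top_iff' _ |>.2 hall)
        refine ⟨Fin.cons g t, Or.inr ?_⟩
        rw [Fin.range_cons]
        have hle : Subgroup.closure (Set.range t) ≤ Subgroup.closure (insert g (Set.range t)) :=
          Subgroup.closure_mono (Set.subset_insert _ _)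
        obtain ⟨m, hm⟩ := Subgroup.card_dvd_of_le hle
        have hm1 : m ≠ 1 := by
          rintro rfl
          rw [mul_one] at hm
          exact hg (Subgroup.eq_of_le_of_card_ge hle hm.le ▸
            Subgroup.subset_closure (Set.mem_insert _ _))
        have hm0 : m ≠ 0 := by
          rintro rfl
          exact Nat.card_pos.ne' hm
        have hm2 : 2 ≤ m := by omega
        rw [hm, pow_succ]
        exact Nat.mul_le_mul hcard hm2
  obtain ⟨t, ht⟩ := key n
  exact ⟨t, ht.elim id fun hle => Subgroup.eq_top_of_le_card _ (h.trans hle)⟩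

theorem exists_closure_range_eq_of_isStabilizerGroup {S : Subgroup (QubitOp n)ˣ}
    (hS : IsStabilizerGroup S) : ∃ t : Fin n → (QubitOp n)ˣ,
      (∀ i, (t i : QubitOp n) ∈ pauliOps n) ∧ Subgroup.closure (Set.range t) = S := by
  have : Finite S := Nat.finite_of_card_ne_zero (by rw [hS.card_eq]; positivity)
  obtain ⟨t, ht⟩ := exists_closure_range_eq_top_of_card_le (G := S) hS.card_eq.le
  refine ⟨fun i => t i, fun i => hS.subset_pauliOps _ (t i).2, ?_⟩
  have h := congrArg (Subgroup.map S.subtype) ht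
  rw [MonoidHom.map_closure, ← Set.range_comp, ← MonoidHom.range_eq_map,
    Subgroup.range_subtype] at h
  exact h

/-- A stabilizer state can be recovered from `n` generators of its stabilizer group. -/
theorem exists_injective_stabilizerClass (n : ℕ) :
    ∃ f : stabilizerClass n → (Fin n → pauliOps n), Function.Injective f := by
  have key : ∀ c : stabilizerClass n, ∃ S : Subgroup (QubitOp n)ˣ, ∃ t : Fin n → (QubitOp n)ˣ,
      ∃ ψ : (Fin n → Fin 2) → ℂ, IsStabilizerGroup S ∧
      (∀ i, (t i : QubitOp n) ∈ pauliOps n) ∧ Subgroup.closure (Set.range t) = S ∧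
      star ψ ⬝ᵥ ψ = 1 ∧ (∀ P ∈ S, (P : QubitOp n) *ᵥ ψ = ψ) ∧
      (c : Effect n → ℝ) = concept (pureState ψ) := by
    rintro ⟨_, _, ⟨S, hS, ψ, hψ, hSψ, rfl⟩, rfl⟩
    obtain ⟨t, ht, htS⟩ := exists_closure_range_eq_of_isStabilizerGroup hS
    exact ⟨S, t, ψ, hS, ht, htS, hψ, hSψ, rfl⟩
  choose S t ψ hS ht htS hψ hSψ hc using key
  refine ⟨fun c i => ⟨t c i, ht c i⟩, fun c c' h => ?_⟩
  have htt : t c = t c' := funext fun i => Units.ext (congrArg Subtype.val (congrFun h i))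
  have hSS : S c = S c' := by rw [← htS c, ← htS c', htt]
  apply Subtype.ext
  rw [hc c, hc c', pureState_eq_of_stabilized (hS c) (hψ c) (hψ c') (hSψ c) (hSS ▸ hSψ c')]

theorem stabilizerClass_finite (n : ℕ) : (stabilizerClass n).Finite := by
  obtain ⟨f, hf⟩ := exists_injective_stabilizerClass n
  have := (pauliOps_finite n).to_subtype
  exact Finite.of_injective f hf

theorem ncard_stabilizerClass_le (n : ℕ) : (stabilizerClass n).ncard ≤ (2 * 4 ^ n) ^ n := by
  obtain ⟨f, hf⟩ := exists_injective_stabilizerClass n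
  have := (pauliOps_finite n).to_subtype
  calc _ = Nat.card (stabilizerClass n) := rfl
    _ ≤ Nat.card (Fin n → pauliOps n) := Nat.card_le_card_of_injective f hf
    _ = _ := by rw [Nat.card_fun, card_pauliOps, Nat.card_fin]

/-! ### Graph states -/

section GraphState

open scoped Fin.CommRing

/-- The sign `(-1) ^ a` of a bit. -/
def bitSign (a : Fin 2) : ℂ := if a = 0 then 1 else -1

theorem bitSign_zero : bitSign 0 = 1 := if_pos rfl

theorem bitSign_add (a b : Fin 2) : bitSign (a + b) = bitSign a * bitSign b := by
  fin_cases a <;> fin_cases b <;> simp [bitSign]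

theorem bitSign_mul_self (a : Fin 2) : bitSign a * bitSign a = 1 := by
  fin_cases a <;> simp [bitSign]

theorem star_bitSign (a : Fin 2) : star (bitSign a) = bitSign a := by
  fin_cases a <;> simp [bitSign]

theorem bitSign_injective : Function.Injective bitSign := by
  intro a b h
  fin_cases a <;> fin_cases b <;> simp_all [bitSign, eq_neg_iff_add_eq_zero, neg_eq_iff_add_eq_zero]

theorem bitSign_sum {ι : Type*} (s : Finset ι) (f : ι → Fin 2) :
    bitSign (∑ i ∈ s, f i) = ∏ i ∈ s, bitSign (f i) := by
  classical
  induction s using Finset.induction_on with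
  | empty => simp [bitSign_zero]
  | insert i s hi ih => rw [Finset.sum_insert hi, Finset.prod_insert hi, bitSign_add, ih]

/-- The quadratic form on bit strings with coefficients `A`. -/
def quadForm (A : Fin n → Fin n → Fin 2) (x : Fin n → Fin 2) : Fin 2 :=
  ∑ i, ∑ j, A i j * x i * x j

theorem quadForm_zero (A : Fin n → Fin n → Fin 2) : quadForm A 0 = 0 := by
  simp [quadForm]

/-- Polarization: the cross term is linear in `x`. This makes the signs of `graphOp` factor over the
qubits. -/
theorem quadForm_add (A : Fin n → Fin n → Fin 2) (x a : Fin n → Fin 2) :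
    quadForm A (x + a) =
      quadForm A x + quadForm A a + ∑ i, (∑ j, (A i j + A j i) * a j) * x i := by
  have h : ∑ i, (∑ j, (A i j + A j i) * a j) * x i =
      ∑ i, ∑ j, (A i j * x i * a j + A i j * a i * x j) := by
    simp only [add_mul, Finset.sum_add_distrib, Finset.sum_mul]
    congr 1
    · exact Finset.sum_congr rfl fun i _ => Finset.sum_congr rfl fun j _ => by ring
    · rw [Finset.sum_comm]
  rw [h]
  simp only [quadForm, ← Finset.sum_add_distrib]
  refine Finset.sum_congr rfl fun i _ => Finset.sum_congr rfl fun j _ => ?_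
  simp only [Pi.add_apply]
  ring

theorem bits_add_self (x : Fin n → Fin 2) : x + x = 0 := by
  funext i
  simp only [Pi.add_apply, Pi.zero_apply]
  generalize x i = b
  revert b
  decide

/-- The operator `X^a`, conjugated by the diagonal operator of signs `(-1) ^ q (x)`, where `q` is
the quadratic form with coefficients `A`. -/
def graphOp (A : Fin n → Fin n → Fin 2) (a : Fin n → Fin 2) : QubitOp n :=
  Matrix.of fun x y =>
    if y = x + a then bitSign (quadForm A x) * bitSign (quadForm A y) else 0

theorem graphOp_apply (A : Fin n → Fin n → Fin 2) (a x y : Fin n → Fin 2) :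
    graphOp A a x y =
      if y = x + a then bitSign (quadForm A x) * bitSign (quadForm A y) else 0 := rfl

theorem graphOp_zero (A : Fin n → Fin n → Fin 2) : graphOp A 0 = 1 := by
  ext x y
  rw [graphOp_apply, Matrix.one_apply, add_zero]
  by_cases h : x = y
  · simp [h, bitSign_mul_self]
  · simp [h, Ne.symm h]

theorem graphOp_add (A : Fin n → Fin n → Fin 2) (a b : Fin n → Fin 2) :
    graphOp A (a + b) = graphOp A a * graphOp A b := by
  ext x z
  simp only [Matrix.mul_apply, graphOp_apply, ite_mul, zero_mul, Finset.sum_ite_eq',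
    Finset.mem_univ, if_true, ← add_assoc]
  split_ifs with h
  · rw [mul_assoc, ← mul_assoc (bitSign (quadForm A (x + a))), bitSign_mul_self, one_mul]
  · simp

theorem graphOp_ne_zero (A : Fin n → Fin n → Fin 2) (a : Fin n → Fin 2) :
    graphOp A a 0 a ≠ 0 := by
  rw [graphOp_apply, if_pos (zero_add a).symm]
  refine mul_ne_zero ?_ ?_ <;> exact left_ne_zero_of_mul_eq_one (bitSign_mul_self _)

theorem graphOp_injective (A : Fin n → Fin n → Fin 2) : Function.Injective (graphOp A) := by
  intro a b h
  by_contra hab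
  refine graphOp_ne_zero A a ?_
  rw [h, graphOp_apply, zero_add, if_neg hab]

/-- The matrix on the left is `Z^l X^a`; the only nontrivial scalar comes from `Z X = i Y`. -/
theorem exists_eq_mul_pauli (a l : Fin 2) : ∃ (c : ℂ) (s : Fin 4), ∀ x y : Fin 2,
    (if y = x + a then bitSign (l * x) else 0) = c * pauli s x y := by
  fin_cases a <;> fin_cases l
  · refine ⟨1, 0, fun x y => ?_⟩
    fin_cases x <;> fin_cases y <;> simp [pauli, bitSign]
  · refine ⟨1, 3, fun x y => ?_⟩
    fin_cases x <;> fin_cases y <;> simp [pauli, bitSign]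
  · refine ⟨1, 1, fun x y => ?_⟩
    fin_cases x <;> fin_cases y <;> simp [pauli, bitSign]
  · refine ⟨Complex.I, 2, fun x y => ?_⟩
    fin_cases x <;> fin_cases y <;> simp [pauli, bitSign]

/-- The sign `(-1) ^ (q (x) + q (x + a))` is `(-1) ^ q (a)` times a character of `x`, so `graphOp A
a` is a scalar multiple of a tensor product of matrices `Z^l X^a`. -/
theorem graphOp_mem_pauliOps (A : Fin n → Fin n → Fin 2) (a : Fin n → Fin 2) :
    graphOp A a ∈ pauliOps n := by
  choose c s hcs using fun i => exists_eq_mul_pauli (a i) (∑ j, (A i j + A j i) * a j)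
  have h : graphOp A a = (bitSign (quadForm A a) * ∏ i, c i) • pauliString s := by
    ext x y
    rw [Matrix.smul_apply, pauliString_apply, smul_eq_mul, mul_assoc, ← Finset.prod_mul_distrib,
      graphOp_apply]
    simp only [← hcs]
    split_ifs with hy
    · rw [hy, quadForm_add, bitSign_add, bitSign_add, ← mul_assoc, ← mul_assoc, bitSign_mul_self,
        one_mul, bitSign_sum]
      simp
    · obtain ⟨i, hi⟩ := Function.ne_iff.1 hy
      rw [Finset.prod_eq_zero (Finset.mem_univ i) (if_neg hi), mul_zero]
  -- Both the operator and the Pauli string square to `I`, so the accumulated scalar, with its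
  -- powers of `i`, squares to `1` and must be `±1`.
  have h1 : graphOp A a * graphOp A a = 1 := by
    rw [← graphOp_add, bits_add_self, graphOp_zero]
  generalize bitSign (quadForm A a) * ∏ i, c i = k at h
  rw [h, Matrix.smul_mul, Matrix.mul_smul, pauliString_mul_self, smul_smul] at h1
  have h2 : k * k = 1 := by simpa using congrFun (congrFun h1 0) 0
  rcases mul_self_eq_one_iff.1 h2 with rfl | rfl
  · exact ⟨s, Or.inl (by simpa using h)⟩
  · exact ⟨s, Or.inr (by simpa using h)⟩

/-- The group homomorphism `a ↦ graphOp A a`. -/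
def graphHom (A : Fin n → Fin n → Fin 2) : Multiplicative (Fin n → Fin 2) →* (QubitOp n)ˣ :=
  MonoidHom.toHomUnits
    { toFun := fun a => graphOp A a.toAdd
      map_one' := graphOp_zero A
      map_mul' := fun a b => graphOp_add A a.toAdd b.toAdd }

theorem graphHom_injective (A : Fin n → Fin n → Fin 2) : Function.Injective (graphHom A) :=
  fun _ _ h => graphOp_injective A (congrArg Units.val h)

theorem isStabilizerGroup_range_graphHom (A : Fin n → Fin n → Fin 2) :
    IsStabilizerGroup (graphHom A).range where
  subset_pauliOps := by
    rintro _ ⟨a, rfl⟩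
    exact graphOp_mem_pauliOps A _
  neg_one_notMem := by
    rintro ⟨a, ha⟩
    have h : graphOp A a.toAdd = -1 := congrArg Units.val ha
    -- The entry of `graphOp A a` at `(0, a)` is nonzero, whereas `-I` is diagonal.
    have h0 : a.toAdd = 0 := by
      by_contra hne
      exact graphOp_ne_zero A a.toAdd (by rw [h]; simp [Ne.symm hne])
    rw [h0, graphOp_zero] at h
    have := congrFun (congrFun h 0) 0
    norm_num [eq_neg_iff_add_eq_zero] at this
  comm := by
    rintro _ ⟨a, rfl⟩ _ ⟨b, rfl⟩
    rw [← map_mul, mul_comm, map_mul]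
  card_eq := by
    rw [← Nat.card_congr (MonoidHom.ofInjective (graphHom_injective A)).toEquiv]
    simp [Nat.card_eq_fintype_card]

/-- The state vector with amplitudes `2 ^ (-n / 2) * (-1) ^ q (x)`. -/
noncomputable def graphVec (A : Fin n → Fin n → Fin 2) (x : Fin n → Fin 2) : ℂ :=
  ((Real.sqrt (2 ^ n))⁻¹ : ℝ) * bitSign (quadForm A x)

theorem sqrt_inv_mul_self (n : ℕ) :
    (((Real.sqrt (2 ^ n))⁻¹ : ℝ) : ℂ) * ((Real.sqrt (2 ^ n))⁻¹ : ℝ) = ((2 : ℂ) ^ n)⁻¹ := by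
  rw [← Complex.ofReal_mul, ← mul_inv, Real.mul_self_sqrt (by positivity)]
  push_cast
  rfl

theorem graphVec_mul_star (A : Fin n → Fin n → Fin 2) (x y : Fin n → Fin 2) :
    graphVec A x * star (graphVec A y) =
      ((2 : ℂ) ^ n)⁻¹ * (bitSign (quadForm A x) * bitSign (quadForm A y)) := by
  rw [graphVec, graphVec, star_mul', star_bitSign, ← sqrt_inv_mul_self, ← starRingEnd_apply,
    Complex.conj_ofReal]
  ring

theorem star_graphVec_dotProduct (A : Fin n → Fin n → Fin 2) :
    star (graphVec A) ⬝ᵥ graphVec A = 1 := by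
  rw [dotProduct_comm]
  simp only [dotProduct, Pi.star_apply, graphVec_mul_star, bitSign_mul_self]
  simp

theorem graphOp_mulVec_graphVec (A : Fin n → Fin n → Fin 2) (a : Fin n → Fin 2) :
    graphOp A a *ᵥ graphVec A = graphVec A := by
  ext x
  simp only [Matrix.mulVec, dotProduct, graphOp_apply, graphVec, ite_mul, zero_mul,
    Finset.sum_ite_eq', Finset.mem_univ, if_true]
  linear_combination ((Real.sqrt (2 ^ n))⁻¹ : ℝ) * bitSign (quadForm A x) *
    bitSign_mul_self (quadForm A (x + a))

theorem concept_graphVec_mem (A : Fin n → Fin n → Fin 2) :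
    concept (pureState (graphVec A)) ∈ stabilizerClass n := by
  refine ⟨_, ⟨_, isStabilizerGroup_range_graphHom A, graphVec A, star_graphVec_dotProduct A, ?_,
    rfl⟩, rfl⟩
  rintro _ ⟨a, rfl⟩
  exact graphOp_mulVec_graphVec A _

theorem quadForm_eq_of_concept_eq {A B : Fin n → Fin n → Fin 2}
    (h : concept (pureState (graphVec A)) = concept (pureState (graphVec B))) :
    quadForm A = quadForm B := by
  have h1 := eq_of_concept_eq (pureState_isHermitian _) (pureState_isHermitian _)
    (trace_pureState (star_graphVec_dotProduct A)) (trace_pureState (star_graphVec_dotProduct B)) h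
  funext x
  -- Since `q (0) = 0`, column `0` of the density matrix is `2⁻ⁿ (-1) ^ q (x)`, free of any phase
  -- ambiguity.
  have h2 := congrFun (congrFun h1 x) 0
  simp only [pureState, Matrix.vecMulVec_apply, Pi.star_apply, graphVec_mul_star, quadForm_zero,
    bitSign_zero, mul_one] at h2
  exact bitSign_injective (mul_left_cancel₀ (by positivity) h2)

/-- The strictly lower triangular matrix with given entries below the diagonal. -/
def lowerTriangular (a : ∀ i : Fin n, Fin i → Fin 2) (i j : Fin n) : Fin 2 :=
  if h : (j : ℕ) < i then a i ⟨j, h⟩ else 0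

/-- The zero diagonal kills the form on basis vectors, leaving only the polar term `A i j + A j i`,
of which one summand is zero. Thus the form determines the entries. -/
theorem quadForm_lowerTriangular_single_add_single (a : ∀ i : Fin n, Fin i → Fin 2) (i : Fin n)
    (j : Fin i) : quadForm (lowerTriangular a)
      (Pi.single i 1 + Pi.single (j.castLE i.2.le) 1) = a i j := by
  have hsingle : ∀ k : Fin n, quadForm (lowerTriangular a) (Pi.single k 1) = 0 := by
    intro k
    simp [quadForm, Pi.single_apply, lowerTriangular]
  rw [quadForm_add, hsingle, hsingle]
  have h1 : Fin.castLE i.2.le j < i := j.2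
  simp [Pi.single_apply, lowerTriangular, h1, h1.not_gt]

theorem two_pow_le_ncard_stabilizerClass (n : ℕ) :
    2 ^ (∑ i ∈ Finset.range n, i) ≤ (stabilizerClass n).ncard := by
  let f : (∀ i : Fin n, Fin i → Fin 2) → stabilizerClass n :=
    fun a => ⟨concept (pureState (graphVec (lowerTriangular a))), concept_graphVec_mem _⟩
  have hf : Function.Injective f := by
    intro a b h
    have hq := quadForm_eq_of_concept_eq (congrArg Subtype.val h)
    funext i j
    rw [← quadForm_lowerTriangular_single_add_single a, hq,
      quadForm_lowerTriangular_single_add_single]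
  have := (stabilizerClass_finite n).to_subtype
  calc _ = Nat.card (∀ i : Fin n, Fin i → Fin 2) := by
        rw [Nat.card_pi, ← Fin.sum_univ_eq_sum_range fun i => i, ← Finset.prod_pow_eq_pow_sum]
        simp
    _ ≤ Nat.card (stabilizerClass n) := Nat.card_le_card_of_injective f hf

theorem stabilizerClass_nonempty (n : ℕ) : (stabilizerClass n).Nonempty :=
  ⟨_, concept_graphVec_mem 0⟩

end GraphState

/-! ### Asymptotics of the number of stabilizer states -/

theorem logb_ncard_stabilizerClass_isTheta :
    (fun n => Real.logb 2 (stabilizerClass n).ncard) =Θ[atTop] fun n : ℕ => (n : ℝ) ^ 2 := by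
  have hpos : ∀ n, (0 : ℝ) < (stabilizerClass n).ncard := fun n => by
    exact_mod_cast (Set.ncard_pos (stabilizerClass_finite n)).2 (stabilizerClass_nonempty n)
  have hlow : ∀ n : ℕ, (n : ℝ) * (n - 1) / 2 ≤ Real.logb 2 (stabilizerClass n).ncard := by
    intro n
    rw [Real.le_logb_iff_rpow_le (by norm_num) (hpos n)]
    have h1 : (n : ℝ) * (n - 1) / 2 = ((∑ i ∈ Finset.range n, i : ℕ) : ℝ) := by
      induction n with
      | zero => simp
      | succ n ih =>
        rw [Finset.sum_range_succ, Nat.cast_add (∑ i ∈ Finset.range n, i), ← ih]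
        push_cast
        ring
    rw [h1, Real.rpow_natCast]
    exact_mod_cast two_pow_le_ncard_stabilizerClass n
  have hup : ∀ n : ℕ, Real.logb 2 (stabilizerClass n).ncard ≤ ((1 + 2 * n) * n : ℕ) := by
    intro n
    rw [Real.logb_le_iff_le_rpow (by norm_num) (hpos n), Real.rpow_natCast, pow_mul, pow_add,
      pow_mul]
    norm_num
    exact_mod_cast ncard_stabilizerClass_le n
  constructor
  -- The exponent `(1 + 2 n) n` is at most `3 n²`.
  · refine Asymptotics.IsBigO.of_bound 3 (eventually_atTop.2 ⟨2, fun n hn => ?_⟩)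
    have hn' : (2 : ℝ) ≤ n := by exact_mod_cast hn
    have h1 := hlow n
    have h2 := hup n
    push_cast at h2
    rw [Real.norm_of_nonneg (by nlinarith), Real.norm_of_nonneg (by positivity)]
    nlinarith
  -- From `n ≥ 2` on, `n (n - 1) / 2 ≥ n² / 4`.
  · refine Asymptotics.IsBigO.of_bound 4 (eventually_atTop.2 ⟨2, fun n hn => ?_⟩)
    have hn' : (2 : ℝ) ≤ n := by exact_mod_cast hn
    have h1 := hlow n
    rw [Real.norm_of_nonneg (by positivity), Real.norm_of_nonneg (by nlinarith)]
    nlinarith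

end StabSDA

/-- For every `n` the class of stabilizer states is finite and its statistical dimension on average
at threshold `2⁻ⁿ` is attained as a maximum; and it equals `2 ^ g n` with `g n = Θ(n²)`. -/
theorem mainTheorem2 :
    (∀ n : ℕ, (StabSDA.stabilizerClass n).Finite ∧
      IsGreatest
        (StabSDA.sdaSet (StabSDA.uniformPauli n) (StabSDA.stabilizerClass n) (1 / 2 ^ n))
        (StabSDA.sda (StabSDA.uniformPauli n) (StabSDA.stabilizerClass n) (1 / 2 ^ n))) ∧
    ∃ g : ℕ → ℝ, g =Θ[atTop] (fun n : ℕ => (n : ℝ) ^ 2) ∧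
      ∀ n : ℕ,
        (StabSDA.sda (StabSDA.uniformPauli n) (StabSDA.stabilizerClass n) (1 / 2 ^ n) : ℝ)
          = (2 : ℝ) ^ g n := by
  have hsda := fun n => StabSDA.sda_stabilizerClass (StabSDA.stabilizerClass_finite n)
    (StabSDA.stabilizerClass_nonempty n)
  refine ⟨fun n => ⟨StabSDA.stabilizerClass_finite n, ?_⟩, _,
    StabSDA.logb_ncard_stabilizerClass_isTheta, fun n => ?_⟩
  · rw [hsda n]
    exact StabSDA.isGreatest_sdaSet_stabilizerClass (StabSDA.stabilizerClass_finite n)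
      (StabSDA.stabilizerClass_nonempty n)
  · have hpos := (Set.ncard_pos (StabSDA.stabilizerClass_finite n)).2
      (StabSDA.stabilizerClass_nonempty n)
    rw [hsda n, Real.rpow_logb (by norm_num) (by norm_num) (by exact_mod_cast hpos)]
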